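/- Let $(K,d)$ be a compact metric space. A continuous map $f:K\to K$ is \emph{Ruelle-expanding} (with constants $r>0$, $0<\lambda<1$, $c>0$) if $d(x,y)>c$ whenever $x\ne y$ and $f(x)=f(y)$, and if for every $x\in K$ and every $a\in f^{-1}(\{x\})$ there is $\phi:B_r(x)\to K$ with $\phi(x)=a$, $f(\phi(y))=y$ and $d(\phi(y),\phi(z))\le\lambda\, d(y,z)$ for all $y,z\in B_r(x)$. A number $\varepsilon>0$ is an \emph{expansive constant} for $f$ if $d(f^n(x),f^n(y))\le\varepsilon$ for all $n\ge 0$ implies $x=y$. \textbf{Theorem.} Let $f:K\to K$ be Ruelle-expanding. Then $N_n(f)=\#\{x\in K: f^n(x)=x\}$ is finite for every $n\ge1$, the series $\sum_{n\ge1}N_n(f)t^n/n$ has positive radius of convergence $\rho\in(0,\infty]$, and the zeta function $$\zeta_f(t)=\exp\Big(\sum_{n\ge1}\frac{N_n(f)}{n}t^n\Big),\qquad t\in\mathbb C,\ |t|<\rho,$$ is a rational function of $t$. Explicitly, $f$ has an expansive constant and, whenever $f$ is Ruelle-expanding with constants $r,\lambda,c$ and $\varepsilon$ is an expansive constant for $f$,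 the following holds. There is a finite cover $\{R_1,\dots,R_k\}$ of $K$ such that (i) each $R_i$ is the closure of its interior and has diameter less than $\min\{\varepsilon,c/2\}$; (ii) $\operatorname{int}R_i\cap\operatorname{int}R_j=\emptyset$ for $i\neq j$; (iii) if $f(\operatorname{int}R_i)\cap\operatorname{int}R_j\ne\emptyset$ then $\operatorname{int}R_j\subseteq f(\operatorname{int}R_i)$. For every such cover, put $A_{ij}=1$ if $f(\operatorname{int}R_i)\cap\operatorname{int}R_j\neq\emptyset$ and $A_{ij}=0$ otherwise. For $r\ge1$ let $I_r$ be the set of all $s=\{s_1<\dots<s_r\}\subseteq\{1,\dots,k\}$ with $\bigcap_{i}R_{s_i}\ne\emptyset$, and let $B^{(r)}$ be the matrix indexed by $I_r$ with $B^{(r)}_{st}=\operatorname{sgn}(\mu)$ if there is a unique permutation $\mu$ of $\{1,\dots,r\}$ with $A_{s_i t_{\mu(i)}}=1$ for all $i$, and $B^{(r)}_{st}=0$ otherwise. Let $L$ be the largest $r\ge 1$ with $I_r\ne\emptyset$ ($L=0$ if there is none). Then, for $|t|<\rho$, $$\zeta_f(t)=\frac{\prod_{1\le r\le L,\ r\text{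 even}}\det(I-tB^{(r)})}{\prod_{1\le r\le L,\ r\text{ odd}}\det(I-tB^{(r)})},$$ where the right-hand side is understood as a rational function, evaluated in lowest terms; its reduced denominator does not vanish for $|t|<\rho$. -/

import Mathlib

/-- `f` is Ruelle-expanding with constants `r`, `lam`, `c`: it is continuous, distinct points with the
same image are more than `c` apart, and every preimage `a` of every point `x` extends to a
`lam`-contracting right inverse of `f` on the open ball of radius `r` about `x`
(only the values of `φ` on that ball matter). -/
structure IsRuelleExpandingWith {K : Type*} [MetricSpace K] (f : K → K) (r lam c : ℝ) : Prop where
  continuous : Continuous f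
  r_pos : 0 < r
  lam_pos : 0 < lam
  lam_lt_one : lam < 1
  c_pos : 0 < c
  separated : ∀ x y : K, x ≠ y → f x = f y → c < dist x y
  branch : ∀ x a : K, f a = x → ∃ φ : K → K, φ x = a ∧
    (∀ y ∈ Metric.ball x r, f (φ y) = y) ∧
    (∀ y ∈ Metric.ball x r, ∀ z ∈ Metric.ball x r, dist (φ y) (φ z) ≤ lam * dist y z)

/-- `f` is Ruelle-expanding. -/
def IsRuelleExpanding {K : Type*} [MetricSpace K] (f : K → K) : Prop :=
  ∃ r lam c : ℝ, IsRuelleExpandingWith f r lam c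

/-- `ε` is a (positive) expansive constant for `f`. -/
def IsExpansiveConstant {K : Type*} [MetricSpace K] (f : K → K) (ε : ℝ) : Prop :=
  0 < ε ∧ ∀ x y : K, (∀ n : ℕ, dist (f^[n] x) (f^[n] y) ≤ ε) → x = y

/-- `N_n(f)`, the number of points `x` with `f^n(x) = x`. -/
noncomputable def periodicCount {K : Type*} (f : K → K) (n : ℕ) : ℕ :=
  (Function.ptsOfPeriod f n).ncard

/-- The coefficients `N_n(f) / n` for `n ≥ 1`, and `0` for `n = 0`. -/
noncomputable def zetaCoeff {K : Type*} (f : K → K) (n : ℕ) : ℂ :=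
  if n = 0 then 0 else (periodicCount f n : ℂ) / (n : ℂ)

/-- The radius of convergence of the power series `∑_{n ≥ 1} N_n(f) tⁿ / n`. -/
noncomputable def zetaRadius {K : Type*} (f : K → K) : ENNReal :=
  (FormalMultilinearSeries.ofScalars ℂ (zetaCoeff f)).radius

/-- The zeta function `ζ_f(t) = exp (∑_{n ≥ 1} N_n(f) tⁿ / n)`, meaningful on the disc of convergence. -/
noncomputable def zetaFun {K : Type*} (f : K → K) (t : ℂ) : ℂ :=
  Complex.exp (∑' n : ℕ, zetaCoeff f n * t ^ n)

/-- On the whole disc of convergence, `ζ_f` equals the rational function `q`, the latter being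
evaluated in lowest terms with nonvanishing denominator. -/
def ZetaEqRatFunc {K : Type*} (f : K → K) (q : RatFunc ℂ) : Prop :=
  ∀ t : ℂ, (‖t‖₊ : ENNReal) < zetaRadius f →
    q.denom.eval t ≠ 0 ∧ zetaFun f t = q.num.eval t / q.denom.eval t

/-- A finite cover `R_1, …, R_k` of `K` by proper sets of diameter less than `δ`, with pairwise
disjoint interiors and the Markov property. -/
structure IsMarkovCover {K : Type*} [MetricSpace K] (f : K → K) (δ : ℝ) {k : ℕ}
    (R : Fin k → Set K) : Prop where
  cover : ⋃ i, R i = Set.univ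
  diam_lt : ∀ i, Metric.diam (R i) < δ
  proper : ∀ i, closure (interior (R i)) = R i
  disjoint : ∀ i j, i ≠ j → interior (R i) ∩ interior (R j) = ∅
  markov : ∀ i j, (f '' interior (R i) ∩ interior (R j)).Nonempty →
    interior (R j) ⊆ f '' interior (R i)

open Classical in
/-- The transition matrix `A`: `A i j = 1` if `f(int R_i)` meets `int R_j`, and `0` otherwise. -/
noncomputable def transitionMatrix {K : Type*} [MetricSpace K] (f : K → K) {k : ℕ}
    (R : Fin k → Set K) : Matrix (Fin k) (Fin k) ℤ :=
  fun i j => if (f '' interior (R i) ∩ interior (R j)).Nonempty then 1 else 0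

/-- `I_r`: the `r`-element sets of indices whose members of the cover have a common point. -/
def CoverIndex {K : Type*} {k : ℕ} (R : Fin k → Set K) (r : ℕ) : Type :=
  {s : Finset (Fin k) // s.card = r ∧ (⋂ i ∈ s, R i).Nonempty}

noncomputable instance {K : Type*} {k : ℕ} (R : Fin k → Set K) (r : ℕ) :
    DecidableEq (CoverIndex R r) := Classical.decEq _

noncomputable instance {K : Type*} {k : ℕ} (R : Fin k → Set K) (r : ℕ) :
    Fintype (CoverIndex R r) :=
  @Fintype.ofFinite _ (Subtype.finite)

/-- The elements `s_1 < … < s_r` of `s ∈ I_r` in increasing order. -/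
def CoverIndex.elt {K : Type*} {k : ℕ} {R : Fin k → Set K} {r : ℕ} (s : CoverIndex R r) :
    Fin r → Fin k :=
  s.1.orderEmbOfFin s.2.1

open Classical in
/-- The signed matrix `B^(r)` indexed by `I_r`: the `(s, t)` entry is `sgn μ` if there is a unique
permutation `μ` with `A (s_i) (t_{μ(i)}) = 1` for all `i`, and `0` otherwise. -/
noncomputable def signedMatrix {K : Type*} [MetricSpace K] (f : K → K) {k : ℕ}
    (R : Fin k → Set K) (r : ℕ) : Matrix (CoverIndex R r) (CoverIndex R r) ℤ :=
  fun s t =>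
    if h : ∃! μ : Equiv.Perm (Fin r), ∀ i, transitionMatrix f R (s.elt i) (t.elt (μ i)) = 1 then
      (Equiv.Perm.sign h.choose : ℤ)
    else 0

open Classical in
/-- `L`: the largest `r ≥ 1` for which `I_r` is nonempty (`0` if there is none). -/
noncomputable def maxOverlap {K : Type*} {k : ℕ} (R : Fin k → Set K) : ℕ :=
  ((Finset.Icc 1 k).filter fun r => Nonempty (CoverIndex R r)).sup id

/-- The polynomial `det (I - t B^(r))` in the variable `t`. -/
noncomputable def detPoly {K : Type*} [MetricSpace K] (f : K → K) {k : ℕ}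
    (R : Fin k → Set K) (r : ℕ) : Polynomial ℂ :=
  (1 - (Polynomial.X : Polynomial ℂ) •
    (signedMatrix f R r).map (fun z : ℤ => Polynomial.C (z : ℂ))).det

/-- The rational function `∏_{r even} det (I - t B^(r)) / ∏_{r odd} det (I - t B^(r))`,
where `r` ranges over `1, …, L`. -/
noncomputable def coverRatFunc {K : Type*} [MetricSpace K] (f : K → K) {k : ℕ}
    (R : Fin k → Set K) : RatFunc ℂ :=
  (∏ r ∈ (Finset.Icc 1 (maxOverlap R)).filter Even,
      algebraMap (Polynomial ℂ) (RatFunc ℂ) (detPoly f R r)) /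
    (∏ r ∈ (Finset.Icc 1 (maxOverlap R)).filter Odd,
      algebraMap (Polynomial ℂ) (RatFunc ℂ) (detPoly f R r))

/-!
# Rationality of the zeta function of a Ruelle-expanding map

**Markov covers.** Local lifts of `f` contract, so pseudo-orbits are shadowed. For a fine finite set
`P`, the points whose orbit is shadowed by a pseudo-orbit starting at `p ∈ P` form a closed set
`shadowCell f P α β p`. These small cells cover the space, and they have a one-step Markov property:
`f` carries a point of a cell into a successor cell, and every point of a successor cell lifts into
the cell. The closures of the atoms of this finite family are a Markov cover
(`IsRuelleExpandingWith.exists_isMarkovCover_of_cells`): a point near `x` whose image lies in the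
same atom as `f x` lies in the same atom as `x`.

**Counting periodic points.** Let `A` be the transition matrix of a Markov cover by sets of diameter
less than `c / 2`. Two members with a common point have no common successor
(`IsMarkovCover.eq_of_transition`), since distinct points of a fibre of `f` are more than `c` apart.
Hence `B^(m)` is a block of the `m`-th compound matrix of `A`, and, for every `x`, each member
through `f x` has exactly one predecessor through `x`. A closed walk of index sets with nonzero
weight is followed by exactly one periodic point (`IsMarkovCover.existsUnique_ptsOfPeriod`), so
`tr (B^(m))^n` is a sum over the points `x` of period `n` of `tr ⋀^m M_x`, where `M_x` is the product
of the restrictions of `A` to the members met along the orbit of `x`. Finally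
`∑_m (-1)^m tr ⋀^m M_x = det (1 - M_x) = 0`, because `M_x` fixes the indicator row vector of the
members through `x`. The term `m = 0` is `1`, whence `N_n(f) = ∑_{m ≥ 1} (-1)^(m+1) tr (B^(m))^n`
(`IsMarkovCover.periodicCount_eq_sum_trace`).

**The zeta function.** Near `0`, `exp (∑ tr (B^n) t^n / n) = 1 / det (1 - t B)` turns this identity
into the formula for the zeta function; the identity theorem extends it to the disc of convergence,
and coprimality of the reduced numerator and denominator excludes zeros of the latter there.
-/

/-! ### Traces of powers and the logarithm of the characteristic determinant -/

/-- Factor `p` over its roots and compare each `det (A - a)` with the characteristic polynomial. -/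
theorem Matrix.det_aeval_eq_prod_roots_charpoly {n K : Type*} [Fintype n] [DecidableEq n] [Field K]
    [IsAlgClosed K] (A : Matrix n n K) (p : Polynomial K) :
    (Polynomial.aeval A p).det = (A.charpoly.roots.map fun x => p.eval x).prod := by
  have hlin : ∀ a : K, (A - Matrix.scalar n a).det = (A.charpoly.roots.map fun x => x - a).prod := by
    intro a
    have h1 := A.eval_charpoly a
    have h2 := (IsAlgClosed.splits A.charpoly).eq_prod_roots_of_monic A.charpoly_monic
    have h3 : (A - Matrix.scalar n a).det = (-1) ^ Fintype.card n * (Matrix.scalar n a - A).det := by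
      rw [← Matrix.det_neg, neg_sub]
    have hc : A.charpoly.roots.card = Fintype.card n := by
      rw [← (IsAlgClosed.splits A.charpoly).natDegree_eq_card_roots,
        Matrix.charpoly_natDegree_eq_dim]
    rw [h3, ← h1, ← hc]
    conv_lhs => rw [h2]
    rw [Polynomial.eval_multiset_prod, Multiset.map_map]
    have h4 := Multiset.prod_map_neg (A.charpoly.roots.map fun x => a - x)
    simp only [Multiset.map_map, Multiset.card_map, Function.comp_def, neg_sub] at h4
    rw [h4]
    simp
  have hp := (IsAlgClosed.splits p).eq_prod_roots
  have key : ∀ s : Multiset K,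
      (Polynomial.aeval A (s.map fun a => Polynomial.X - Polynomial.C a).prod).det =
      (A.charpoly.roots.map fun x =>
        ((s.map fun a => Polynomial.X - Polynomial.C a).prod).eval x).prod := by
    intro s
    induction s using Multiset.induction_on with
    | empty => simp
    | cons a s ih =>
      simp only [Multiset.map_cons, Multiset.prod_cons, map_mul, Matrix.det_mul, ih,
        Polynomial.eval_mul, Multiset.prod_map_mul]
      congr 1
      simpa [Matrix.algebraMap_eq_diagonal, Pi.algebraMap_def] using hlin a
  have hc : A.charpoly.roots.card = Fintype.card n := by
    rw [← (IsAlgClosed.splits A.charpoly).natDegree_eq_card_roots,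
      Matrix.charpoly_natDegree_eq_dim]
  rw [hp]
  simp only [map_mul, Matrix.det_mul, key, Polynomial.eval_mul, Multiset.prod_map_mul,
    Polynomial.eval_C, Polynomial.aeval_C]
  congr 1
  simp [Matrix.algebraMap_eq_diagonal, hc]

/-- The characteristic polynomial of `A ^ m` is found by evaluating `det (z - A ^ m)` at
every `z`. -/
theorem Matrix.trace_pow_eq_sum_roots_charpoly {n K : Type*} [Fintype n] [DecidableEq n] [Field K]
    [IsAlgClosed K] (A : Matrix n n K) (m : ℕ) :
    (A ^ m).trace = (A.charpoly.roots.map fun x => x ^ m).sum := by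
  have h : (A ^ m).charpoly =
      ((A.charpoly.roots.map fun x => x ^ m).map fun a => Polynomial.X - Polynomial.C a).prod := by
    refine Polynomial.funext fun z => ?_
    rw [Matrix.eval_charpoly, Polynomial.eval_multiset_prod]
    have := A.det_aeval_eq_prod_roots_charpoly (Polynomial.C z - Polynomial.X ^ m)
    simpa [Matrix.algebraMap_eq_diagonal, Pi.algebraMap_def, Multiset.map_map,
      Function.comp_def] using this
  rw [Matrix.trace_eq_sum_roots_charpoly, h, Polynomial.roots_multiset_prod_X_sub_C]

theorem Matrix.eval_charpolyRev_eq_prod_roots_charpoly {n K : Type*} [Fintype n] [DecidableEq n]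
    [Field K] [IsAlgClosed K] (A : Matrix n n K) (t : K) :
    A.charpolyRev.eval t = (A.charpoly.roots.map fun x => 1 - t * x).prod := by
  have := A.det_aeval_eq_prod_roots_charpoly (1 - Polynomial.C t * Polynomial.X)
  simp only [map_sub, map_one, map_mul, Polynomial.aeval_C, Polynomial.aeval_X,
    Polynomial.eval_sub, Polynomial.eval_one, Polynomial.eval_mul, Polynomial.eval_C,
    Polynomial.eval_X] at this
  rw [← this, Matrix.charpolyRev, ← Polynomial.coe_evalRingHom, RingHom.map_det]
  congr 1
  ext i j
  rcases eq_or_ne i j with hij | hij <;>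
    simp [hij, Matrix.algebraMap_eq_diagonal, mul_comm (A _ _)]

/-- Near `0` the series `∑ tr (A ^ m) t ^ m / m` is `-log det (1 - t A)`. The statement is in
multiplicative form; its term of index `0` vanishes, being a division by zero. -/
theorem Matrix.exists_hasSum_trace_pow_exp_mul_charpolyRev {n : Type*} [Fintype n] [DecidableEq n]
    (A : Matrix n n ℂ) :
    ∀ᶠ t : ℂ in nhds 0, ∃ S : ℂ, HasSum (fun m : ℕ => (A ^ m).trace / (m : ℂ) * t ^ m) S ∧
      Complex.exp S * A.charpolyRev.eval t = 1 := by
  have key : ∀ s : Multiset ℂ, ∀ᶠ t : ℂ in nhds 0, ∃ S : ℂ,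
      HasSum (fun m : ℕ => (s.map fun x => x ^ m).sum / (m : ℂ) * t ^ m) S ∧
      Complex.exp S * (s.map fun x => 1 - t * x).prod = 1 := by
    intro s
    induction s using Multiset.induction_on with
    | empty => exact Filter.Eventually.of_forall fun t => ⟨0, by simp, by simp⟩
    | cons a s ih =>
      have hcont : ∀ᶠ t : ℂ in nhds 0, ‖t * a‖ < 1 := by
        have : Filter.Tendsto (fun t : ℂ => ‖t * a‖) (nhds 0) (nhds ‖(0 : ℂ) * a‖) :=
          (by fun_prop : Continuous fun t : ℂ => ‖t * a‖).tendsto 0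
        exact this.eventually_lt_const (by simp)
      filter_upwards [ih, hcont] with t ⟨S, hS, hexp⟩ hta
      have hlog := Complex.hasSum_taylorSeries_neg_log hta
      refine ⟨-Complex.log (1 - t * a) + S, ?_, ?_⟩
      · refine (hlog.add hS).congr_fun ?_
        intro m
        simp only [Multiset.map_cons, Multiset.sum_cons, mul_pow]
        ring
      · have hne : 1 - t * a ≠ 0 := by
          intro h
          rw [sub_eq_zero] at h
          rw [← h] at hta
          simp at hta
        rw [Multiset.map_cons, Multiset.prod_cons, Complex.exp_add, Complex.exp_neg,
          Complex.exp_log hne]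
        field_simp
        linear_combination hexp
  filter_upwards [key A.charpoly.roots] with t ⟨S, hS, hexp⟩
  refine ⟨S, ?_, ?_⟩
  · simpa only [Matrix.trace_pow_eq_sum_roots_charpoly] using hS
  · rwa [Matrix.eval_charpolyRev_eq_prod_roots_charpoly]

/-! ### Walk expansions and compound matrices -/

/-- An entry of a product of matrices is a sum over walks. -/
theorem Matrix.list_ofFn_prod_apply {ι S : Type*} [Fintype ι] [DecidableEq ι] [CommRing S] :
    ∀ (n : ℕ) (M : Fin n → Matrix ι ι S) (s t : ι),
      (List.ofFn M).prod s t = ∑ w : Fin (n + 1) → ι,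
        if w 0 = s ∧ w (Fin.last n) = t then ∏ i, M i (w i.castSucc) (w i.succ) else 0 := by
  intro n
  induction n with
  | zero =>
    intro M s t
    rw [← (Equiv.funUnique (Fin 1) ι).symm.sum_comp]
    simp [Matrix.one_apply, ite_and, eq_comm]
  | succ n ih =>
    intro M s t
    rw [List.ofFn_succ, List.prod_cons, Matrix.mul_apply]
    simp only [ih]
    rw [← (Fin.consEquiv fun _ : Fin (n + 2) => ι).sum_comp, Fintype.sum_prod_type]
    simp only [Fin.consEquiv_apply, Fin.cons_zero, ← Fin.succ_last, Fin.cons_succ,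
      Fin.prod_univ_succ (n := n), Fin.castSucc_zero]
    simp only [ite_and, Finset.sum_ite_irrel, Finset.sum_const_zero, Finset.sum_ite_eq',
      Finset.mem_univ, if_true]
    simp only [Finset.mul_sum]
    rw [Finset.sum_comm]
    refine Finset.sum_congr rfl fun w _ => ?_
    simp only [← Fin.succ_castSucc, Fin.cons_succ]
    simp

theorem Matrix.trace_list_ofFn_prod {ι S : Type*} [Fintype ι] [DecidableEq ι] [CommRing S]
    (n : ℕ) (M : Fin n → Matrix ι ι S) :
    (List.ofFn M).prod.trace = ∑ w : Fin (n + 1) → ι,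
      if w 0 = w (Fin.last n) then ∏ i, M i (w i.castSucc) (w i.succ) else 0 := by
  simp only [Matrix.trace, Matrix.diag_apply, Matrix.list_ofFn_prod_apply]
  rw [Finset.sum_comm]
  refine Finset.sum_congr rfl fun w _ => ?_
  simp [ite_and, eq_comm]

/-- If every factor vanishes on the columns outside the range of an injection `e`, the trace of a
product only sees the entries indexed by that range. -/
theorem Matrix.trace_list_ofFn_prod_submatrix {ι κ S : Type*} [Fintype ι] [DecidableEq ι]
    [Fintype κ] [DecidableEq κ] [CommRing S] (e : ι → κ) (he : Function.Injective e) {n : ℕ}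
    (hn : n ≠ 0) (N : Fin n → Matrix κ κ S) (hN : ∀ i a b, b ∉ Set.range e → N i a b = 0) :
    (List.ofFn fun i => (N i).submatrix e e).prod.trace = (List.ofFn N).prod.trace := by
  rw [Matrix.trace_list_ofFn_prod, Matrix.trace_list_ofFn_prod]
  refine Fintype.sum_of_injective (fun w => e ∘ w) he.comp_left _ _ ?_ ?_
  · intro w hw
    split_ifs with h
    · obtain ⟨m, rfl⟩ := Nat.exists_eq_succ_of_ne_zero hn
      obtain ⟨j, hj⟩ : ∃ j, w j ∉ Set.range e := by
        by_contra! hall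
        choose v hv using hall
        exact hw ⟨v, funext hv⟩
      have hj' : ∃ i : Fin (m + 1), w i.succ ∉ Set.range e := by
        rcases Fin.eq_zero_or_eq_succ j with rfl | ⟨i, rfl⟩
        · exact ⟨Fin.last m, by rwa [Fin.succ_last, ← h]⟩
        · exact ⟨i, hj⟩
      obtain ⟨i, hi⟩ := hj'
      exact Finset.prod_eq_zero (Finset.mem_univ i) (hN _ _ _ hi)
    · rfl
  · intro w
    simp [he.eq_iff]

/-- The `r`-th compound matrix: its entries are the `r × r` minors. -/
noncomputable def Matrix.compound {k : ℕ} {S : Type*} [CommRing S] (r : ℕ)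
    (M : Matrix (Fin k) (Fin k) S) :
    Matrix (Set.powersetCard (Fin k) r) (Set.powersetCard (Fin k) r) S :=
  Matrix.of fun s t =>
    (M.submatrix (s.1.orderEmbOfFin s.2) (t.1.orderEmbOfFin t.2)).det

/-- The compound matrix is the matrix of the exterior power of the linear map, in the basis of
exterior products of basis vectors. -/
theorem Matrix.compound_eq_toMatrix {k : ℕ} {S : Type*} [CommRing S] (r : ℕ)
    (M : Matrix (Fin k) (Fin k) S) :
    M.compound r = LinearMap.toMatrix ((Pi.basisFun S (Fin k)).exteriorPower r)
      ((Pi.basisFun S (Fin k)).exteriorPower r) (exteriorPower.map r (Matrix.toLin' M)) := by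
  ext s t
  rw [LinearMap.toMatrix_apply, exteriorPower.basis_repr_apply, exteriorPower.basis_apply,
    exteriorPower.map_apply_ιMulti_family, exteriorPower.ιMulti_family,
    exteriorPower.ιMultiDual_apply_ιMulti, ← Matrix.det_transpose]
  simp only [Matrix.compound, Matrix.of_apply]
  congr 1
  ext i j
  simp [Set.powersetCard.ofFinEmbEquiv_symm_apply]

/-- The Cauchy–Binet formula, as functoriality of the exterior power. -/
theorem Matrix.compound_list_prod {k : ℕ} {S : Type*} [CommRing S] (r : ℕ)
    (l : List (Matrix (Fin k) (Fin k) S)) :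
    l.prod.compound r = (l.map (Matrix.compound r)).prod := by
  induction l with
  | nil =>
    rw [List.prod_nil, List.map_nil, List.prod_nil, Matrix.compound_eq_toMatrix,
      Matrix.toLin'_one, exteriorPower.map_id, LinearMap.toMatrix_id]
  | cons M l ih =>
    rw [List.prod_cons, List.map_cons, List.prod_cons, ← ih]
    rw [Matrix.compound_eq_toMatrix, Matrix.toLin'_mul, exteriorPower.map_comp,
      LinearMap.toMatrix_comp _ ((Pi.basisFun S (Fin k)).exteriorPower r) _,
      ← Matrix.compound_eq_toMatrix, ← Matrix.compound_eq_toMatrix]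

theorem Matrix.trace_compound {k : ℕ} {S : Type*} [CommRing S] (r : ℕ)
    (M : Matrix (Fin k) (Fin k) S) :
    (M.compound r).trace = (1 + (Polynomial.X : Polynomial S) • M.map Polynomial.C).det.coeff r := by
  rw [Matrix.coeff_det_one_add_X_smul_eq_sum_minors, Matrix.trace]
  refine Finset.sum_bij (fun s _ => s.1) ?_ ?_ ?_ ?_
  · intro s _
    simp [Finset.mem_powersetCard]
  · intro s _ t _ h
    exact Subtype.ext h
  · intro s hs
    exact ⟨⟨s, (Finset.mem_powersetCard.mp hs).2⟩, Finset.mem_univ _, rfl⟩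
  · intro s _
    simp only [Matrix.diag_apply, Matrix.compound, Matrix.of_apply]
    rw [← Matrix.det_submatrix_equiv_self (s.1.orderIsoOfFin s.2).toEquiv]
    rfl

/-- The alternating sum of the traces of the compound matrices is `det (1 - M)`. -/
theorem Matrix.sum_neg_one_pow_mul_trace_compound {k : ℕ} {S : Type*} [CommRing S]
    (M : Matrix (Fin k) (Fin k) S) :
    ∑ r ∈ Finset.range (k + 1), (-1) ^ r * (M.compound r).trace = (1 - M).det := by
  set p := (1 + (Polynomial.X : Polynomial S) • M.map Polynomial.C).det with hp
  have hdeg : p.natDegree < k + 1 := by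
    have := Polynomial.natDegree_det_X_add_C_le M 1
    rw [Fintype.card_fin] at this
    rw [hp, add_comm]
    refine Nat.lt_succ_of_le (le_trans (le_of_eq ?_) this)
    congr 3
    ext i j : 1
    rcases eq_or_ne i j with h | h <;> simp [h, Matrix.one_apply]
  have h1 : p.eval (-1) = (1 - M).det := by
    rw [hp, ← Polynomial.coe_evalRingHom, RingHom.map_det]
    congr 1
    ext i j
    rcases eq_or_ne i j with h | h <;> simp [h, sub_eq_add_neg]
  rw [← h1, Polynomial.eval_eq_sum_range' hdeg]
  exact Finset.sum_congr rfl fun r _ => by rw [Matrix.trace_compound, mul_comm]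

/-! ### Ruelle-expanding maps -/

section RuelleExpanding

variable {K : Type*} [MetricSpace K] {f : K → K} {r lam c : ℝ}

/-- Points of the `r`-ball about `f x` lift through `f` to points near `x`, by a factor `lam`. -/
theorem IsRuelleExpandingWith.exists_lift (hf : IsRuelleExpandingWith f r lam c) (x y : K)
    (h : dist y (f x) < r) : ∃ z, f z = y ∧ dist z x ≤ lam * dist y (f x) := by
  obtain ⟨φ, hφ, hinv, hcontr⟩ := hf.branch (f x) x rfl
  have hy : y ∈ Metric.ball (f x) r := h
  have hx : f x ∈ Metric.ball (f x) r := Metric.mem_ball_self hf.r_pos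
  exact ⟨φ y, hinv y hy, by simpa [hφ] using hcontr y hy (f x) hx⟩

theorem IsRuelleExpandingWith.eq_of_dist_le (hf : IsRuelleExpandingWith f r lam c) {x y : K}
    (h : dist x y ≤ c) (he : f x = f y) : x = y := by
  by_contra hne
  exact absurd (hf.separated x y hne he) (not_lt.mpr h)

theorem IsRuelleExpandingWith.isOpenMap (hf : IsRuelleExpandingWith f r lam c) :
    IsOpenMap f := by
  intro U hU
  rw [Metric.isOpen_iff]
  rintro _ ⟨x, hx, rfl⟩
  obtain ⟨δ, hδ, hball⟩ := Metric.isOpen_iff.mp hU x hx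
  refine ⟨min r δ, lt_min hf.r_pos hδ, fun y hy => ?_⟩
  obtain ⟨z, rfl, hz⟩ := hf.exists_lift x y (lt_of_lt_of_le hy (min_le_left _ _))
  refine ⟨z, hball ?_, rfl⟩
  have h1 : dist (f z) (f x) < δ := lt_of_lt_of_le hy (min_le_right _ _)
  have h2 : lam * dist (f z) (f x) ≤ 1 * dist (f z) (f x) :=
    mul_le_mul_of_nonneg_right hf.lam_lt_one.le dist_nonneg
  rw [Metric.mem_ball]
  linarith

/-- A lift followed by the separation of fibres shows that orbits which stay close are contracted
backwards, so that half the smaller of `c` and `r` is an expansive constant. -/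
theorem IsRuelleExpandingWith.isExpansiveConstant (hf : IsRuelleExpandingWith f r lam c) :
    IsExpansiveConstant f (min (c / 2) (r / 2)) := by
  have hc := hf.c_pos
  have hr := hf.r_pos
  refine ⟨by positivity, fun x y h => ?_⟩
  set ε := min (c / 2) (r / 2) with hε
  have hεc : ε ≤ c / 2 := min_le_left _ _
  have hεr : ε ≤ r / 2 := min_le_right _ _
  have step : ∀ a b : K, dist a b ≤ ε → dist (f a) (f b) ≤ ε →
      dist a b ≤ lam * dist (f a) (f b) := by
    intro a b hab hfab
    obtain ⟨z, hz, hzd⟩ := hf.exists_lift b (f a) (by linarith)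
    have h1 : lam * dist (f a) (f b) ≤ 1 * ε :=
      mul_le_mul hf.lam_lt_one.le hfab dist_nonneg zero_le_one
    have h2 : dist z a ≤ c := by
      have := dist_triangle z b a
      rw [dist_comm b a] at this
      linarith
    rwa [hf.eq_of_dist_le h2 hz] at hzd
  have hpow : ∀ n : ℕ, ∀ m : ℕ, dist (f^[m] x) (f^[m] y) ≤ lam ^ n * ε := by
    intro n
    induction n with
    | zero => intro m; simpa using h m
    | succ n ih =>
      intro m
      have h1 := step _ _ (h m) (by
        have := h (m + 1)
        rwa [Function.iterate_succ_apply', Function.iterate_succ_apply'] at this)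
      have h2 := ih (m + 1)
      rw [Function.iterate_succ_apply', Function.iterate_succ_apply'] at h2
      calc _ ≤ _ := h1
        _ ≤ lam * (lam ^ n * ε) := mul_le_mul_of_nonneg_left h2 hf.lam_pos.le
        _ = _ := by ring
  have hlim : Filter.Tendsto (fun n : ℕ => lam ^ n * ε) Filter.atTop (nhds (0 * ε)) :=
    (tendsto_pow_atTop_nhds_zero_of_lt_one hf.lam_pos.le hf.lam_lt_one).mul_const ε
  rw [zero_mul] at hlim
  have h0 : dist x y ≤ 0 := ge_of_tendsto' hlim fun n => hpow n 0
  exact dist_le_zero.mp h0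

end RuelleExpanding

/-! ### Counting periodic points -/

section PeriodicPoints

variable {K : Type*} [MetricSpace K] {f : K → K} {ε : ℝ}

/-- Two periodic points whose orbits stay within an expansive constant during one period agree. -/
theorem IsExpansiveConstant.eq_of_ptsOfPeriod (hε : IsExpansiveConstant f ε) {n : ℕ} (hn : 1 ≤ n)
    {x y : K} (hx : x ∈ Function.ptsOfPeriod f n) (hy : y ∈ Function.ptsOfPeriod f n)
    (h : ∀ m < n, dist (f^[m] x) (f^[m] y) ≤ ε) : x = y := by
  refine hε.2 x y fun m => ?_
  have hx' : Function.IsPeriodicPt f n x := hx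
  have hy' : Function.IsPeriodicPt f n y := hy
  rw [← hx'.iterate_mod_apply m, ← hy'.iterate_mod_apply m]
  exact h _ (Nat.mod_lt _ hn)

/-- Recording the members of a finite cover by small balls that the orbit visits embeds the points
of period `n` into the words of length `n`. -/
theorem IsExpansiveConstant.exists_periodicCount_le [CompactSpace K]
    (hε : IsExpansiveConstant f ε) : ∃ N : ℕ, ∀ n, 1 ≤ n →
      (Function.ptsOfPeriod f n).Finite ∧ periodicCount f n ≤ N ^ n := by
  obtain ⟨P, -, hPfin, hP⟩ := (isCompact_univ (X := K)).finite_cover_balls (half_pos hε.1)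
  have hP' : ∀ x : K, ∃ p : P, dist x p < ε / 2 := by
    intro x
    have := hP (Set.mem_univ x)
    simp only [Set.mem_iUnion, Metric.mem_ball] at this
    obtain ⟨p, hp, hd⟩ := this
    exact ⟨⟨p, hp⟩, hd⟩
  choose code hcode using hP'
  have : Finite P := hPfin
  refine ⟨Nat.card P, fun n hn => ?_⟩
  let word : Function.ptsOfPeriod f n → (Fin n → P) := fun x i => code (f^[i] x.1)
  have hword : Function.Injective word := by
    intro x y hxy
    refine Subtype.ext (hε.eq_of_ptsOfPeriod hn x.2 y.2 fun m hm => ?_)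
    have h1 := hcode (f^[m] x.1)
    have h2 := hcode (f^[m] y.1)
    have h3 : code (f^[m] x.1) = code (f^[m] y.1) := congrFun hxy ⟨m, hm⟩
    rw [← h3, dist_comm] at h2
    rw [dist_comm] at h2
    have := dist_triangle_right (f^[m] x.1) (f^[m] y.1) (code (f^[m] x.1) : K)
    linarith
  refine ⟨Set.finite_coe_iff.mp (Finite.of_injective word hword), ?_⟩
  have := Nat.card_le_card_of_injective word hword
  rw [Nat.card_fun, Nat.card_eq_fintype_card (α := Fin n), Fintype.card_fin] at this
  exact this

end PeriodicPoints

theorem zetaRadius_pos_of_periodicCount_le {K : Type*} {f : K → K} {N : ℕ}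
    (h : ∀ n, 1 ≤ n → periodicCount f n ≤ N ^ n) : 0 < zetaRadius f := by
  have hN : (0 : ℝ) < N + 1 := by positivity
  let ρ : NNReal := ⟨((N : ℝ) + 1)⁻¹, by positivity⟩
  have hρ : (0 : ENNReal) < ρ := by
    rw [ENNReal.coe_pos, ← NNReal.coe_pos]
    exact inv_pos.mpr hN
  refine lt_of_lt_of_le hρ
    (FormalMultilinearSeries.le_radius_of_bound _ 1 fun n => ?_)
  have hcoeff : ‖zetaCoeff f n‖ ≤ ((N : ℝ) + 1) ^ n := by
    unfold zetaCoeff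
    split_ifs with hn
    · simp [hn]
    · have hn1 : 1 ≤ n := Nat.one_le_iff_ne_zero.mpr hn
      rw [norm_div, Complex.norm_natCast, Complex.norm_natCast]
      have h1 : (periodicCount f n : ℝ) ≤ (N : ℝ) ^ n := by exact_mod_cast h n hn1
      have h2 : (1 : ℝ) ≤ n := by exact_mod_cast hn1
      calc (periodicCount f n : ℝ) / n ≤ periodicCount f n := div_le_self (by positivity) h2
        _ ≤ (N : ℝ) ^ n := h1
        _ ≤ _ := pow_le_pow_left₀ (by positivity) (by linarith) n
  rw [FormalMultilinearSeries.ofScalars_norm]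
  calc ‖zetaCoeff f n‖ * (ρ : ℝ) ^ n ≤ ((N : ℝ) + 1) ^ n * (((N : ℝ) + 1)⁻¹) ^ n :=
        mul_le_mul_of_nonneg_right hcoeff (by positivity)
    _ = 1 := by rw [← mul_pow, mul_inv_cancel₀ hN.ne', one_pow]

/-! ### Markov covers -/

section MarkovCover

variable {K : Type*} [MetricSpace K] {f : K → K} {r lam c : ℝ}

/-- The atom of the family `T` determined by `J`: the points interior to `T i` for `i ∈ J` and
outside `T i` for `i ∉ J`. Points on the boundary of some `T i` lie in no atom. -/
def familyAtom {ι : Type*} (T : ι → Set K) (J : Set ι) : Set K :=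
  {x | ∀ i, (i ∈ J → x ∈ interior (T i)) ∧ (i ∉ J → x ∉ T i)}

theorem mem_familyAtom_iff_mem {ι : Type*} {T : ι → Set K} {J : Set ι} {x : K}
    (hx : x ∈ familyAtom T J) (i : ι) : x ∈ T i ↔ i ∈ J := by
  constructor
  · intro h
    by_contra hi
    exact (hx i).2 hi h
  · intro hi
    exact interior_subset ((hx i).1 hi)

theorem isOpen_familyAtom {ι : Type*} [Finite ι] {T : ι → Set K} (hT : ∀ i, IsClosed (T i))
    (J : Set ι) : IsOpen (familyAtom T J) := by
  have : familyAtom T J = ⋂ i, {x | (i ∈ J → x ∈ interior (T i)) ∧ (i ∉ J → x ∉ T i)} := by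
    ext x
    simp [familyAtom]
  rw [this]
  refine isOpen_iInter_of_finite fun i => ?_
  by_cases hi : i ∈ J
  · simp [hi]
  · simp only [hi, false_imp_iff, not_false_eq_true, true_imp_iff, true_and]
    exact (hT i).isOpen_compl

theorem disjoint_familyAtom {ι : Type*} {T : ι → Set K} {J J' : Set ι} (h : J ≠ J') :
    Disjoint (familyAtom T J) (familyAtom T J') := by
  rw [Set.disjoint_left]
  intro x hx hx'
  refine h (Set.ext fun i => ?_)
  rw [← mem_familyAtom_iff_mem hx, mem_familyAtom_iff_mem hx']

/-- The boundaries of finitely many closed sets are nowhere dense, so the atoms fill a dense set. -/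
theorem iUnion_closure_familyAtom [CompactSpace K] {ι : Type*} [Finite ι] {T : ι → Set K}
    (hT : ∀ i, IsClosed (T i)) : ⋃ J, closure (familyAtom T J) = Set.univ := by
  have hdense : Dense (⋂ i, (frontier (T i))ᶜ) := by
    refine dense_iInter_of_isOpen (fun i => isClosed_frontier.isOpen_compl) fun i => ?_
    rw [← interior_eq_empty_iff_dense_compl]
    exact interior_frontier (hT i)
  rw [← closure_iUnion_of_finite, ← Set.univ_subset_iff, ← hdense.closure_eq]
  refine closure_mono fun x hx => Set.mem_iUnion.mpr ⟨{i | x ∈ T i}, fun i => ⟨fun hi => ?_, id⟩⟩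
  by_contra hint
  exact Set.mem_iInter.mp hx i ⟨subset_closure hi, hint⟩

theorem disjoint_interior_closure {X : Type*} [TopologicalSpace X] {U V : Set X} (hV : IsOpen V)
    (h : Disjoint U V) : Disjoint (interior (closure U)) (interior (closure V)) :=
  (((h.closure_left hV).mono_left interior_subset).closure_right isOpen_interior).mono_right
    interior_subset

/-- A finite closed cover by small sets along which `f` has the one-step Markov property with
respect to a relation `E` refines to a Markov cover: the members are the closures of the atoms. -/
theorem IsRuelleExpandingWith.exists_isMarkovCover_of_cells [CompactSpace K]
    (hf : IsRuelleExpandingWith f r lam c) {ι : Type*} [Finite ι] {T : ι → Set K}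
    {E : ι → ι → Prop} {δ η : ℝ} (hη : 0 < η) (hηδ : η < δ) (hηr : η < r) (hηc : 2 * η ≤ c)
    (hclosed : ∀ i, IsClosed (T i)) (hcover : ∀ x, ∃ i, x ∈ T i)
    (hsmall : ∀ i, ∀ x ∈ T i, ∀ y ∈ T i, dist x y ≤ η)
    (hforward : ∀ j, ∀ x ∈ T j, ∃ t, E j t ∧ f x ∈ T t)
    (hbackward : ∀ j t, E j t → ∀ y ∈ T t, ∃ z ∈ T j, f z = y) :
    ∃ (k : ℕ) (R : Fin k → Set K), IsMarkovCover f δ R := by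
  have hopen := isOpen_familyAtom hclosed
  -- Close points whose images lie in the same cells lie in the same cells themselves.
  have hpattern : ∀ x z : K, dist x z ≤ η → (∀ t, f x ∈ T t → f z ∈ T t) →
      ∀ j, x ∈ T j → z ∈ T j := by
    intro x z hxz hfxz j hj
    obtain ⟨t, hjt, hxt⟩ := hforward j x hj
    obtain ⟨z', hz', hfz'⟩ := hbackward j t hjt (f z) (hfxz t hxt)
    have h1 := hsmall j z' hz' x hj
    have h2 := dist_triangle z' x z
    rwa [← hf.eq_of_dist_le (by linarith : dist z' z ≤ c) hfz']
  have hsub : ∀ J' (x z : K), f x ∈ familyAtom T J' → f z ∈ familyAtom T J' →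
      dist x z ≤ η → ∀ j, x ∈ T j → z ∈ T j := by
    intro J' x z hx hz hxz
    refine hpattern x z hxz fun t ht => ?_
    rw [mem_familyAtom_iff_mem hz, ← mem_familyAtom_iff_mem hx]
    exact ht
  -- The set of such points `z` is open, which gives interiority in the cells of `J`.
  have hatom : ∀ J J' (x z : K), x ∈ familyAtom T J → f x ∈ familyAtom T J' →
      f z ∈ familyAtom T J' → dist z x < η → z ∈ familyAtom T J := by
    intro J J' x z hx hfx hfz hzx i
    refine ⟨fun hi => ?_, fun hi hzi => hi ?_⟩
    · refine mem_interior.mpr ⟨f ⁻¹' familyAtom T J' ∩ Metric.ball x η, ?_, ?_, hfz, hzx⟩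
      · rintro w ⟨hfw, hwx⟩
        rw [Metric.mem_ball, dist_comm] at hwx
        exact hsub J' x w hfx hfw hwx.le i ((mem_familyAtom_iff_mem hx i).mpr hi)
      · exact ((hopen J').preimage hf.continuous).inter Metric.isOpen_ball
    · rw [← mem_familyAtom_iff_mem hx]
      exact hsub J' z x hfz hfx hzx.le i hzi
  have hdist : ∀ J, ∀ x ∈ familyAtom T J, ∀ y ∈ familyAtom T J, dist x y ≤ η := by
    intro J x hx y hy
    obtain ⟨i, hi⟩ := hcover x
    refine hsmall i x hi y ?_
    rwa [mem_familyAtom_iff_mem hy, ← mem_familyAtom_iff_mem hx]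
  have hdist' : ∀ J, ∀ x ∈ familyAtom T J, ∀ y ∈ closure (familyAtom T J), dist y x ≤ η := by
    intro J x hx y hy
    have : closure (familyAtom T J) ⊆ Metric.closedBall x η :=
      closure_minimal (fun z hz => hdist J z hz x hx) Metric.isClosed_closedBall
    exact this hy
  have hmarkov : ∀ J J', (f '' interior (closure (familyAtom T J)) ∩
      interior (closure (familyAtom T J'))).Nonempty →
      interior (closure (familyAtom T J')) ⊆ f '' interior (closure (familyAtom T J)) := by
    rintro J J' ⟨p, hpJ, hpJ'⟩ y hy
    have hfU : IsOpen (f '' interior (closure (familyAtom T J))) :=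
      hf.isOpenMap _ isOpen_interior
    obtain ⟨_, ⟨u, hu, rfl⟩, hfu⟩ := mem_closure_iff.mp (interior_subset hpJ') _ hfU hpJ
    obtain ⟨x, hfx, hx⟩ := mem_closure_iff.mp (interior_subset hu) _
      ((hopen J').preimage hf.continuous) hfu
    have hyx : dist y (f x) ≤ η := hdist' J' _ hfx y (interior_subset hy)
    obtain ⟨z, rfl, hz⟩ := hf.exists_lift x y (hyx.trans_lt hηr)
    have hzx : dist z x < η := by
      have h1 := mul_le_mul_of_nonneg_left hyx hf.lam_pos.le
      have h2 := mul_lt_mul_of_pos_right hf.lam_lt_one hη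
      linarith
    -- Near `z`, the map `f` is open and sends a dense set of points into the atom of `J'`.
    have hW : IsOpen (f ⁻¹' interior (closure (familyAtom T J')) ∩ Metric.ball x η) :=
      (isOpen_interior.preimage hf.continuous).inter Metric.isOpen_ball
    refine ⟨z, mem_interior.mpr ⟨_, ?_, hW, hy, hzx⟩, rfl⟩
    rintro w hw
    refine mem_closure_iff.mpr fun V hV hwV => ?_
    obtain ⟨_, ⟨v, ⟨hvV, hvW⟩, rfl⟩, hfv⟩ := mem_closure_iff.mp (interior_subset hw.1) _
      (hf.isOpenMap _ (hV.inter hW)) ⟨w, ⟨hwV, hw⟩, rfl⟩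
    exact ⟨v, hvV, hatom J J' x v hx hfx hfv hvW.2⟩
  obtain ⟨k, ⟨e⟩⟩ := Finite.exists_equiv_fin (Set ι)
  refine ⟨k, fun i => closure (familyAtom T (e.symm i)), ?_, ?_, ?_, ?_, ?_⟩
  · rw [e.symm.surjective.iUnion_comp fun J => closure (familyAtom T J)]
    exact iUnion_closure_familyAtom hclosed
  · intro i
    rw [Metric.diam_closure]
    exact (Metric.diam_le_of_forall_dist_le hη.le (hdist _)).trans_lt hηδ
  · intro i
    exact (closure_minimal interior_subset isClosed_closure).antisymm
      (closure_mono (interior_maximal subset_closure (hopen _)))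
  · intro i j hij
    exact (disjoint_interior_closure (hopen _)
      (disjoint_familyAtom (e.symm.injective.ne hij))).inter_eq
  · intro i j
    exact hmarkov _ _

/-- The points whose orbit is `α`-shadowed by a `β`-pseudo-orbit in `P` starting at `p`. -/
def shadowCell (f : K → K) (P : Set K) (α β : ℝ) (p : P) : Set K :=
  {x | ∃ s : ℕ → P, s 0 = p ∧ (∀ n, dist (f (s n)) (s (n + 1)) ≤ β) ∧
    ∀ n, dist (f^[n] x) (s n) ≤ α}

theorem isClosed_shadowCell (hf : Continuous f) (P : Set K) [Finite P] (α β : ℝ) (p : P) :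
    IsClosed (shadowCell f P α β p) := by
  have hC : IsClosed {q : K × (ℕ → P) | q.2 0 = p ∧
      (∀ n, dist (f (q.2 n)) (q.2 (n + 1)) ≤ β) ∧ ∀ n, dist (f^[n] q.1) (q.2 n) ≤ α} := by
    simp only [Set.ofPred_and, Set.ofPred_forall]
    refine IsClosed.inter ?_ (IsClosed.inter ?_ ?_)
    · exact isClosed_eq (by fun_prop) continuous_const
    · exact isClosed_iInter fun n => isClosed_le (by fun_prop) continuous_const
    · refine isClosed_iInter fun n => isClosed_le ?_ continuous_const
      have := hf.iterate n
      fun_prop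
  have := isClosedMap_fst_of_compactSpace _ hC
  convert this using 1
  ext x
  simp [shadowCell]

theorem shadowCell_forward {P : Set K} {α β : ℝ} {p : P} {x : K} (hx : x ∈ shadowCell f P α β p) :
    ∃ t : P, dist (f p) t ≤ β ∧ f x ∈ shadowCell f P α β t := by
  obtain ⟨s, rfl, hs, hd⟩ := hx
  exact ⟨s 1, hs 0, fun n => s (n + 1), rfl, fun n => hs (n + 1), fun n => hd (n + 1)⟩

theorem IsRuelleExpandingWith.shadowCell_backward (hf : IsRuelleExpandingWith f r lam c)
    {P : Set K} {α β : ℝ} (hαβ : α + β < r) (hlam : lam * (α + β) ≤ α) {p t : P}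
    (hpt : dist (f p) t ≤ β) {y : K} (hy : y ∈ shadowCell f P α β t) :
    ∃ z ∈ shadowCell f P α β p, f z = y := by
  obtain ⟨s, rfl, hs, hd⟩ := hy
  have h1 : dist y (f p) ≤ α + β := by
    have h2 := dist_triangle_right y (f p) (s 0 : K)
    have h3 := hd 0
    rw [Function.iterate_zero_apply] at h3
    linarith
  obtain ⟨z, rfl, hz⟩ := hf.exists_lift p y (h1.trans_lt hαβ)
  refine ⟨z, ⟨fun n => Nat.casesOn n p s, rfl, ?_, ?_⟩, rfl⟩
  · rintro (_ | n)
    · exact hpt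
    · exact hs n
  · rintro (_ | n)
    · exact hz.trans ((mul_le_mul_of_nonneg_left h1 hf.lam_pos.le).trans hlam)
    · exact hd n

theorem exists_mem_shadowCell {P : Set K} {α β γ : ℝ} (hγα : γ ≤ α) (hγβ : γ ≤ β / 2)
    (hunif : ∀ a b : K, dist a b < γ → dist (f a) (f b) < β / 2)
    (hP : ∀ x : K, ∃ p : P, dist x p < γ) (x : K) : ∃ p, x ∈ shadowCell f P α β p := by
  choose s hs using fun n : ℕ => hP (f^[n] x)
  refine ⟨s 0, s, rfl, fun n => ?_, fun n => (hs n).le.trans hγα⟩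
  have h1 := hunif _ _ (hs n)
  have h2 := hs (n + 1)
  rw [Function.iterate_succ_apply'] at h2
  have h3 := dist_triangle_left (f (s n)) (s (n + 1) : K) (f (f^[n] x))
  linarith

theorem IsRuelleExpandingWith.exists_isMarkovCover [CompactSpace K]
    (hf : IsRuelleExpandingWith f r lam c) {δ : ℝ} (hδ : 0 < δ) :
    ∃ (k : ℕ) (R : Fin k → Set K), IsMarkovCover f δ R := by
  have hr := hf.r_pos
  have hc := hf.c_pos
  have hl := hf.lam_pos
  have hl1 := hf.lam_lt_one
  obtain ⟨α, hα, hαm⟩ : ∃ α : ℝ, 0 < α ∧ 4 * α < min δ (min r c) :=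
    ⟨min δ (min r c) / 5, by positivity, by
      have : 0 < min δ (min r c) := by positivity
      linarith⟩
  obtain ⟨hαδ, hαr, hαc⟩ : 4 * α < δ ∧ 4 * α < r ∧ 4 * α < c := by simpa using hαm
  -- With this `β`, a `lam`-contracting lift of the `α + β`-ball lands in the `α`-ball.
  obtain ⟨β, hβ, hβα, hlβ⟩ : ∃ β : ℝ, 0 < β ∧ β ≤ α ∧ lam * (α + β) ≤ α := by
    refine ⟨(1 - lam) * α, mul_pos (by linarith) hα, by nlinarith, ?_⟩
    nlinarith [mul_nonneg hα.le (sq_nonneg (1 - lam))]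
  obtain ⟨γ₀, hγ₀, hunif⟩ := Metric.uniformContinuous_iff.mp
    (CompactSpace.uniformContinuous_of_continuous hf.continuous) (β / 2) (by positivity)
  set γ := min γ₀ (β / 2) with hγ
  have hγβ : γ ≤ β / 2 := min_le_right _ _
  obtain ⟨P, -, hPfin, hP⟩ := (isCompact_univ (X := K)).finite_cover_balls
    (show 0 < γ by positivity)
  have hP' : ∀ x : K, ∃ p : P, dist x p < γ := by
    intro x
    have := hP (Set.mem_univ x)
    simp only [Set.mem_iUnion, Metric.mem_ball] at this
    obtain ⟨p, hp, hd⟩ := this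
    exact ⟨⟨p, hp⟩, hd⟩
  have : Finite P := hPfin
  refine hf.exists_isMarkovCover_of_cells (T := shadowCell f P α β)
    (E := fun p t => dist (f p) t ≤ β) (η := 2 * α) (by linarith) (by linarith) (by linarith)
    (by linarith) (isClosed_shadowCell hf.continuous P α β)
    (exists_mem_shadowCell (by linarith) hγβ
      (fun a b h => hunif (h.trans_le (min_le_left _ _))) hP') ?_ ?_ ?_
  · rintro p x ⟨s, hs, -, hx⟩ y ⟨s', hs', -, hy⟩
    have h1 := hx 0
    have h2 := hy 0
    rw [hs, Function.iterate_zero_apply] at h1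
    rw [hs', Function.iterate_zero_apply] at h2
    have := dist_triangle_right x y (p : K)
    linarith
  · exact fun p x hx => shadowCell_forward hx
  · exact fun p t hpt y hy => hf.shadowCell_backward (by linarith) hlβ hpt hy

end MarkovCover

/-! ### Coding by a Markov cover -/

section Coding

variable {K : Type*} [MetricSpace K] {f : K → K} {r lam c δ ε : ℝ} {k : ℕ} {R : Fin k → Set K}

theorem transitionMatrix_eq_one_iff {i j : Fin k} : transitionMatrix f R i j = 1 ↔
    (f '' interior (R i) ∩ interior (R j)).Nonempty := by
  unfold transitionMatrix
  split_ifs with h <;> simp [h]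

theorem transitionMatrix_eq_zero_of_ne_one {i j : Fin k} (h : transitionMatrix f R i j ≠ 1) :
    transitionMatrix f R i j = 0 := by
  rw [Ne, transitionMatrix_eq_one_iff] at h
  exact if_neg h

theorem IsMarkovCover.isClosed (hR : IsMarkovCover f δ R) (i : Fin k) : IsClosed (R i) := by
  rw [← hR.proper i]
  exact isClosed_closure

theorem IsMarkovCover.exists_mem (hR : IsMarkovCover f δ R) (x : K) : ∃ i, x ∈ R i := by
  simpa using hR.cover.ge (Set.mem_univ x)

theorem IsMarkovCover.dist_lt [CompactSpace K] (hR : IsMarkovCover f δ R) {i : Fin k} {x y : K}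
    (hx : x ∈ R i) (hy : y ∈ R i) : dist x y < δ :=
  (Metric.dist_le_diam_of_mem Metric.isBounded_of_compactSpace hx hy).trans_lt (hR.diam_lt i)

theorem IsMarkovCover.exists_mem_interior_of_open (hR : IsMarkovCover f δ R) {i : Fin k}
    {V : Set K} (hV : IsOpen V) (h : (V ∩ R i).Nonempty) : (V ∩ interior (R i)).Nonempty := by
  obtain ⟨x, hxV, hx⟩ := h
  rw [← hR.proper i] at hx
  exact mem_closure_iff.mp hx V hV hxV

theorem IsMarkovCover.exists_lift [CompactSpace K] (hf : IsRuelleExpandingWith f r lam c)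
    (hR : IsMarkovCover f δ R) {a b : Fin k} (hab : transitionMatrix f R a b = 1) {y : K}
    (hy : y ∈ R b) : ∃ x ∈ R a, f x = y := by
  have h1 := hR.markov a b (transitionMatrix_eq_one_iff.mp hab)
  have h2 : IsClosed (f '' R a) := ((hR.isClosed a).isCompact.image hf.continuous).isClosed
  rw [← hR.proper b] at hy
  exact closure_minimal (h1.trans (Set.image_mono interior_subset)) h2 hy

/-- Members of the cover with a common point have no common successor: the two preimages of an
interior point of a common successor would lie in a set of diameter at most `c`, hence coincide. -/
theorem IsMarkovCover.eq_of_transition [CompactSpace K] (hf : IsRuelleExpandingWith f r lam c)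
    (hR : IsMarkovCover f δ R) (hδ : δ ≤ c / 2) {a a' b : Fin k} {x : K} (hx : x ∈ R a)
    (hx' : x ∈ R a') (hb : (R b).Nonempty) (hab : transitionMatrix f R a b = 1)
    (hab' : transitionMatrix f R a' b = 1) : a = a' := by
  obtain ⟨z, -, hz⟩ := hR.exists_mem_interior_of_open (i := b) isOpen_univ (by simpa using hb)
  obtain ⟨u, hu, hfu⟩ := hR.markov a b (transitionMatrix_eq_one_iff.mp hab) hz
  obtain ⟨u', hu', hfu'⟩ := hR.markov a' b (transitionMatrix_eq_one_iff.mp hab') hz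
  have h1 := hR.dist_lt (interior_subset hu) hx
  have h2 := hR.dist_lt hx' (interior_subset hu')
  have h3 := dist_triangle u x u'
  have h4 : u = u' := hf.eq_of_dist_le (by linarith) (hfu.trans hfu'.symm)
  by_contra hne
  have : u ∈ interior (R a) ∩ interior (R a') := ⟨hu, h4 ▸ hu'⟩
  rw [hR.disjoint a a' hne] at this
  exact this

/-- Every member of the cover through `f x` has a predecessor through `x`. -/
theorem IsMarkovCover.exists_predecessor (hf : IsRuelleExpandingWith f r lam c)
    (hR : IsMarkovCover f δ R) {b : Fin k} {x : K} (hx : f x ∈ R b) :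
    ∃ a, x ∈ R a ∧ transitionMatrix f R a b = 1 := by
  have hopen : IsOpen (f ⁻¹' interior (R b)) := isOpen_interior.preimage hf.continuous
  have h1 : x ∈ closure (f ⁻¹' interior (R b)) := by
    refine hf.isOpenMap.preimage_closure_subset_closure_preimage ?_
    rwa [Set.mem_preimage, hR.proper b]
  have h2 : f ⁻¹' interior (R b) = ⋃ a, f ⁻¹' interior (R b) ∩ R a := by
    rw [← Set.inter_iUnion, hR.cover, Set.inter_univ]
  rw [h2, closure_iUnion_of_finite] at h1
  obtain ⟨a, ha⟩ := Set.mem_iUnion.mp h1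
  refine ⟨a, ?_, ?_⟩
  · rw [← (hR.isClosed a).closure_eq]
    exact closure_mono Set.inter_subset_right ha
  · have hne : (f ⁻¹' interior (R b) ∩ R a).Nonempty := closure_nonempty_iff.mp ⟨x, ha⟩
    obtain ⟨z, hzb, hza⟩ := hR.exists_mem_interior_of_open hopen hne
    exact transitionMatrix_eq_one_iff.mpr ⟨f z, ⟨z, hza, rfl⟩, hzb⟩

/-! ### The signed matrices as blocks of compound matrices -/

open Classical in
/-- For a matrix of zeros and ones with at most one `1` in each column, at most one term of the
Leibniz expansion is nonzero. -/
theorem Matrix.det_of_zero_one_of_column_unique {r : ℕ} (D : Matrix (Fin r) (Fin r) ℤ)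
    (h01 : ∀ i j, D i j ≠ 1 → D i j = 0) (hcol : ∀ i i' j, D i j = 1 → D i' j = 1 → i = i') :
    D.det = if h : ∃! μ : Equiv.Perm (Fin r), ∀ i, D i (μ i) = 1 then
      (Equiv.Perm.sign h.choose : ℤ) else 0 := by
  rw [← Matrix.det_transpose, Matrix.det_apply']
  split_ifs with h
  · rw [Finset.sum_eq_single h.choose]
    · have hone : ∀ i, D i (h.choose i) = 1 := h.choose_spec.1
      simp [Matrix.transpose_apply, hone]
    · intro σ _ hσ
      have hnot : ¬ ∀ i, D i (σ i) = 1 := fun hσ' => hσ (h.choose_spec.2 σ hσ')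
      push Not at hnot
      obtain ⟨i, hi⟩ := hnot
      have h0 : ∏ i, D.transpose (σ i) i = 0 :=
        Finset.prod_eq_zero (Finset.mem_univ i) (h01 _ _ hi)
      rw [h0, mul_zero]
    · simp
  · refine Finset.sum_eq_zero fun σ _ => ?_
    have hnot : ¬ ∀ i, D i (σ i) = 1 := by
      intro hσ
      refine h ⟨σ, hσ, fun τ hτ => Equiv.ext fun i => ?_⟩
      have h1 := hσ (σ.symm (τ i))
      rw [Equiv.apply_symm_apply] at h1
      rw [← σ.symm.injective.eq_iff, σ.symm_apply_apply]
      exact (hcol _ _ _ (hτ i) h1).symm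
    push Not at hnot
    obtain ⟨i, hi⟩ := hnot
    have h0 : ∏ i, D.transpose (σ i) i = 0 :=
      Finset.prod_eq_zero (Finset.mem_univ i) (h01 _ _ hi)
    rw [h0, mul_zero]

theorem CoverIndex.elt_mem {K : Type*} {k : ℕ} {R : Fin k → Set K} {m : ℕ}
    (s : CoverIndex R m) (i : Fin m) : s.elt i ∈ s.1 :=
  Finset.orderEmbOfFin_mem _ _ _

theorem CoverIndex.exists_elt_eq {K : Type*} {k : ℕ} {R : Fin k → Set K} {m : ℕ}
    (s : CoverIndex R m) {a : Fin k} (ha : a ∈ s.1) :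
    ∃ i, s.elt i = a := by
  have := Finset.range_orderEmbOfFin s.1 s.2.1
  rwa [← Finset.mem_coe, ← this] at ha

/-- The signed matrix consists of minors of the transition matrix: each column of such a minor has
at most one `1`, by `IsMarkovCover.eq_of_transition`. -/
theorem IsMarkovCover.signedMatrix_eq_det [CompactSpace K] (hf : IsRuelleExpandingWith f r lam c)
    (hR : IsMarkovCover f δ R) (hδ : δ ≤ c / 2) {m : ℕ} (s t : CoverIndex R m) :
    signedMatrix f R m s t = ((transitionMatrix f R).submatrix s.elt t.elt).det := by
  obtain ⟨x, hx⟩ := s.2.2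
  obtain ⟨y, hy⟩ := t.2.2
  rw [Set.mem_iInter₂] at hx hy
  rw [Matrix.det_of_zero_one_of_column_unique]
  · rfl
  · exact fun i j h => transitionMatrix_eq_zero_of_ne_one h
  · intro i i' j h h'
    exact (s.1.orderEmbOfFin s.2.1).injective (hR.eq_of_transition hf hδ (hx _ (s.elt_mem i))
      (hx _ (s.elt_mem i')) ⟨y, hy _ (t.elt_mem j)⟩ h h')

open Classical in
/-- The transition matrix restricted to the members of the cover through `x` (rows) and through
`y` (columns), extended by zero. -/
noncomputable def pointTransition (f : K → K) (R : Fin k → Set K) (x y : K) :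
    Matrix (Fin k) (Fin k) ℤ :=
  Matrix.of fun a b => if x ∈ R a ∧ y ∈ R b then transitionMatrix f R a b else 0

/-- An element of `I_m`, as an `m`-element set of indices. -/
def CoverIndex.toPowersetCard {m : ℕ} (s : CoverIndex R m) : Set.powersetCard (Fin k) m :=
  ⟨s.1, s.2.1⟩

theorem CoverIndex.toPowersetCard_injective {K : Type*} {k : ℕ} {R : Fin k → Set K} {m : ℕ} :
    Function.Injective (CoverIndex.toPowersetCard (R := R) (m := m)) := by
  intro s t h
  exact Subtype.ext (congrArg (fun u : Set.powersetCard (Fin k) m => u.1) h)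

open Classical in
theorem IsMarkovCover.compound_pointTransition [CompactSpace K]
    (hf : IsRuelleExpandingWith f r lam c) (hR : IsMarkovCover f δ R) (hδ : δ ≤ c / 2) {m : ℕ}
    (x y : K) (s t : CoverIndex R m) :
    (pointTransition f R x y).compound m s.toPowersetCard t.toPowersetCard =
      if x ∈ (⋂ i ∈ s.1, R i) ∧ y ∈ (⋂ i ∈ t.1, R i) then signedMatrix f R m s t else 0 := by
  change ((pointTransition f R x y).submatrix s.elt t.elt).det = _
  split_ifs with h
  · rw [hR.signedMatrix_eq_det hf hδ]
    rw [Set.mem_iInter₂, Set.mem_iInter₂] at h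
    congr 1
    ext i j
    exact if_pos ⟨h.1 _ (s.elt_mem i), h.2 _ (t.elt_mem j)⟩
  · rw [not_and_or, Set.mem_iInter₂, Set.mem_iInter₂] at h
    rcases h with h | h
    · push Not at h
      obtain ⟨a, ha, hxa⟩ := h
      obtain ⟨i, rfl⟩ := s.exists_elt_eq ha
      exact Matrix.det_eq_zero_of_row_eq_zero i fun j => if_neg fun h => hxa h.1
    · push Not at h
      obtain ⟨b, hb, hyb⟩ := h
      obtain ⟨j, rfl⟩ := t.exists_elt_eq hb
      exact Matrix.det_eq_zero_of_column_eq_zero j fun i => if_neg fun h => hyb h.2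

theorem compound_pointTransition_eq_zero {m : ℕ} (x y : K)
    (s t : Set.powersetCard (Fin k) m)
    (ht : t ∉ Set.range (CoverIndex.toPowersetCard (R := R) (m := m))) :
    (pointTransition f R x y).compound m s t = 0 := by
  have hy : ¬ y ∈ ⋂ i ∈ t.1, R i := fun hy => ht ⟨⟨t.1, t.2, y, hy⟩, rfl⟩
  rw [Set.mem_iInter₂] at hy
  push Not at hy
  obtain ⟨b, hb, hyb⟩ := hy
  have hb' : b ∈ Set.range (t.1.orderEmbOfFin t.2) :=
    (Finset.range_orderEmbOfFin t.1 t.2).ge hb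
  obtain ⟨j, rfl⟩ := hb'
  exact Matrix.det_eq_zero_of_column_eq_zero j fun i => if_neg fun h => hyb h.2

/-- The indicator vector of the members through a point is carried along the orbit: every member
through `f x` has exactly one predecessor through `x`. -/
theorem IsMarkovCover.vecMul_pointTransition [CompactSpace K]
    (hf : IsRuelleExpandingWith f r lam c) (hR : IsMarkovCover f δ R) (hδ : δ ≤ c / 2) (x : K) :
    Matrix.vecMul (fun a => Set.indicator (R a) 1 x) (pointTransition f R x (f x)) =
      fun b => Set.indicator (R b) (1 : K → ℤ) (f x) := by
  classical
  ext b
  rw [Matrix.vecMul, dotProduct]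
  by_cases hb : f x ∈ R b
  · obtain ⟨a, ha, hab⟩ := hR.exists_predecessor hf hb
    rw [Finset.sum_eq_single a]
    · simp [pointTransition, ha, hb, hab]
    · intro a' _ hne
      by_cases ha' : x ∈ R a'
      · have h : transitionMatrix f R a' b ≠ 1 := fun h =>
          hne (hR.eq_of_transition hf hδ ha' ha ⟨_, hb⟩ h hab)
        simp [pointTransition, transitionMatrix_eq_zero_of_ne_one h]
      · simp [ha']
    · simp
  · simp [pointTransition, hb]

theorem IsMarkovCover.vecMul_prod_pointTransition [CompactSpace K]
    (hf : IsRuelleExpandingWith f r lam c) (hR : IsMarkovCover f δ R) (hδ : δ ≤ c / 2) (n : ℕ)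
    (x : K) : Matrix.vecMul (fun a => Set.indicator (R a) 1 x)
      (List.ofFn fun i : Fin n => pointTransition f R (f^[i] x) (f^[i + 1] x)).prod =
      fun b => Set.indicator (R b) (1 : K → ℤ) (f^[n] x) := by
  induction n generalizing x with
  | zero => simp
  | succ n ih =>
    rw [List.ofFn_succ, List.prod_cons, ← Matrix.vecMul_vecMul]
    have h := hR.vecMul_pointTransition hf hδ x
    simp only [Fin.val_zero, Fin.val_succ, Function.iterate_zero_apply, zero_add,
      Function.iterate_succ_apply] at ih h ⊢
    rw [h, ih]

/-- Along the orbit of a point of period `n`, the alternating sum of the traces is `1`: the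
indicator vector is fixed, so that `1` is an eigenvalue of the product. -/
theorem IsMarkovCover.sum_trace_compound_prod [CompactSpace K]
    (hf : IsRuelleExpandingWith f r lam c) (hR : IsMarkovCover f δ R) (hδ : δ ≤ c / 2) {n : ℕ}
    {x : K} (hx : x ∈ Function.ptsOfPeriod f n) :
    ∑ m ∈ Finset.Icc 1 k, (-1) ^ (m + 1) * ((List.ofFn fun i : Fin n =>
      pointTransition f R (f^[i] x) (f^[i + 1] x)).prod.compound m).trace = 1 := by
  set M := (List.ofFn fun i : Fin n => pointTransition f R (f^[i] x) (f^[i + 1] x)).prod with hM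
  have hdet : (1 - M).det = 0 := by
    rw [← Matrix.exists_vecMul_eq_zero_iff]
    refine ⟨fun a => Set.indicator (R a) 1 x, ?_, ?_⟩
    · obtain ⟨a, ha⟩ := hR.exists_mem x
      intro h0
      have := congrFun h0 a
      simp [ha] at this
    · have hx' : f^[n] x = x := hx
      rw [Matrix.vecMul_sub, hM, hR.vecMul_prod_pointTransition hf hδ, hx', Matrix.vecMul_one,
        sub_self]
  have h0 : (M.compound 0).trace = 1 := by
    rw [Matrix.trace_compound, Matrix.coeff_det_one_add_X_smul_eq_sum_minors]
    simp
  have hsum := M.sum_neg_one_pow_mul_trace_compound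
  rw [hdet, Finset.sum_range_succ', h0] at hsum
  have hIcc : ∀ g : ℕ → ℤ, ∑ m ∈ Finset.Icc 1 k, g m = ∑ m ∈ Finset.range k, g (m + 1) := by
    intro g
    rw [Finset.range_eq_Ico, Finset.sum_Ico_add' g 0 k 1]
    rfl
  rw [hIcc]
  simp only [pow_succ, mul_neg, mul_one, neg_neg, neg_mul, Finset.sum_neg_distrib,
    pow_zero] at hsum ⊢
  linarith

/-! ### Closed walks and periodic points -/

/-- Lifts of a point into the members indexed by `s` coincide, since those members meet and have
diameter less than `c / 2`. -/
theorem IsMarkovCover.exists_lift_iInter [CompactSpace K] (hf : IsRuelleExpandingWith f r lam c)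
    (hR : IsMarkovCover f δ R) (hδ : δ ≤ c / 2) {m : ℕ} (hm : 1 ≤ m) {s t : CoverIndex R m}
    (hst : signedMatrix f R m s t ≠ 0) {y : K} (hy : y ∈ ⋂ i ∈ t.1, R i) :
    ∃ x ∈ ⋂ i ∈ s.1, R i, f x = y := by
  have hex : ∃! μ : Equiv.Perm (Fin m),
      ∀ i, transitionMatrix f R (s.elt i) (t.elt (μ i)) = 1 := by
    by_contra h
    exact hst (dif_neg h)
  obtain ⟨μ, hμ, -⟩ := hex
  rw [Set.mem_iInter₂] at hy
  choose x hx hfx using fun i => hR.exists_lift hf (hμ i) (hy _ (t.elt_mem (μ i)))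
  obtain ⟨p, hp⟩ := s.2.2
  rw [Set.mem_iInter₂] at hp
  have heq : ∀ i j, x i = x j := by
    intro i j
    have h1 := hR.dist_lt (hx i) (hp _ (s.elt_mem i))
    have h2 := hR.dist_lt (hp _ (s.elt_mem j)) (hx j)
    have h3 := dist_triangle (x i) p (x j)
    exact hf.eq_of_dist_le (by linarith) ((hfx i).trans (hfx j).symm)
  refine ⟨x ⟨0, hm⟩, Set.mem_iInter₂.mpr fun a ha => ?_, hfx _⟩
  obtain ⟨i, rfl⟩ := s.exists_elt_eq ha
  rw [heq _ i]
  exact hx i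

/-- An infinite admissible walk of index sets is followed by the orbit of some point. -/
theorem IsMarkovCover.exists_forall_iterate_mem [CompactSpace K]
    (hf : IsRuelleExpandingWith f r lam c) (hR : IsMarkovCover f δ R) (hδ : δ ≤ c / 2) {m : ℕ}
    (hm : 1 ≤ m) {W : ℕ → CoverIndex R m} (hW : ∀ i, signedMatrix f R m (W i) (W (i + 1)) ≠ 0) :
    ∃ x, ∀ i, f^[i] x ∈ ⋂ a ∈ (W i).1, R a := by
  have hfin : ∀ N j : ℕ, ∃ x, ∀ i ≤ N, f^[i] x ∈ ⋂ a ∈ (W (j + i)).1, R a := by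
    intro N
    induction N with
    | zero =>
      intro j
      obtain ⟨x, hx⟩ := (W j).2.2
      exact ⟨x, fun i hi => by rw [Nat.le_zero.mp hi]; exact hx⟩
    | succ N ih =>
      intro j
      obtain ⟨y, hy⟩ := ih (j + 1)
      obtain ⟨x, hx, rfl⟩ := hR.exists_lift_iInter hf hδ hm (hW j) (hy 0 (Nat.zero_le _))
      refine ⟨x, fun i hi => ?_⟩
      rcases i with _ | i
      · exact hx
      · have := hy i (Nat.le_of_succ_le_succ hi)
        rwa [add_right_comm, ← Function.iterate_succ_apply] at this
  have hclosed : ∀ N, IsClosed {x | ∀ i ≤ N, f^[i] x ∈ ⋂ a ∈ (W i).1, R a} := by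
    intro N
    simp only [Set.ofPred_forall]
    refine isClosed_iInter fun i => isClosed_iInter fun _ => ?_
    exact (isClosed_biInter fun a _ => hR.isClosed a).preimage (hf.continuous.iterate i)
  obtain ⟨x, hx⟩ := IsCompact.nonempty_iInter_of_sequence_nonempty_isCompact_isClosed
    (fun N => {x | ∀ i ≤ N, f^[i] x ∈ ⋂ a ∈ (W i).1, R a})
    (fun N x hx i hi => hx i (Nat.le_succ_of_le hi))
    (fun N => by obtain ⟨x, hx⟩ := hfin N 0; exact ⟨x, by simpa using hx⟩)
    (hclosed 0).isCompact hclosed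
  exact ⟨x, fun i => Set.mem_iInter.mp hx i i le_rfl⟩

theorem CoverIndex.exists_mem_val {K : Type*} {k : ℕ} {R : Fin k → Set K} {m : ℕ}
    (hm : 1 ≤ m) (s : CoverIndex R m) : ∃ a, a ∈ s.1 :=
  ⟨s.elt ⟨0, hm⟩, s.elt_mem _⟩

/-- A closed walk of index sets with nonzero weight is followed by exactly one point of period
`n`. -/
theorem IsMarkovCover.existsUnique_ptsOfPeriod [CompactSpace K]
    (hf : IsRuelleExpandingWith f r lam c) (hε : IsExpansiveConstant f ε)
    (hR : IsMarkovCover f δ R) (hδ : δ ≤ c / 2) (hδε : δ ≤ ε) {m n : ℕ} (hm : 1 ≤ m) (hn : 1 ≤ n)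
    {w : Fin (n + 1) → CoverIndex R m} (hw : w 0 = w (Fin.last n))
    (hne : ∀ i : Fin n, signedMatrix f R m (w i.castSucc) (w i.succ) ≠ 0) :
    ∃! x, x ∈ Function.ptsOfPeriod f n ∧
      ∀ i : Fin (n + 1), f^[i] x ∈ ⋂ a ∈ (w i).1, R a := by
  have hclose : ∀ (s : CoverIndex R m) (x y : K), x ∈ (⋂ a ∈ s.1, R a) → y ∈ (⋂ a ∈ s.1, R a) →
      dist x y ≤ ε := by
    intro s x y hx hy
    obtain ⟨a, ha⟩ := s.exists_mem_val hm
    rw [Set.mem_iInter₂] at hx hy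
    exact (hR.dist_lt (hx a ha) (hy a ha)).le.trans hδε
  -- The closed walk, continued periodically.
  let W : ℕ → CoverIndex R m := fun i => w ⟨i % n, Nat.lt_succ_of_lt (Nat.mod_lt i hn)⟩
  have hWw : ∀ i : Fin (n + 1), W i = w i := by
    intro i
    rcases Nat.lt_succ_iff_lt_or_eq.mp i.2 with h | h
    · exact congrArg w (Fin.ext (Nat.mod_eq_of_lt h))
    · have h1 : i = Fin.last n := Fin.ext h
      rw [h1, ← hw]
      exact congrArg w (Fin.ext (Nat.mod_self n))
  have hWmod : ∀ i, W (i % n) = W i := fun i => congrArg w (Fin.ext (Nat.mod_mod i n))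
  have hW : ∀ i, signedMatrix f R m (W i) (W (i + 1)) ≠ 0 := by
    intro i
    have h1 : W (i + 1) = W (i % n + 1) := congrArg w (Fin.ext (Nat.mod_add_mod i n 1).symm)
    have h2 := hne ⟨i % n, Nat.mod_lt i hn⟩
    rw [← hWw, ← hWw] at h2
    rw [h1, ← hWmod i]
    exact h2
  obtain ⟨x, hx⟩ := hR.exists_forall_iterate_mem hf hδ hm hW
  have hper : f^[n] x = x := by
    refine hε.2 _ _ fun i => hclose (W i) _ _ ?_ (hx i)
    have h1 : W (i + n) = W i := congrArg w (Fin.ext (Nat.add_mod_right i n))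
    rw [← Function.iterate_add_apply, ← h1]
    exact hx (i + n)
  refine ⟨x, ⟨hper, fun i => ?_⟩, ?_⟩
  · rw [← hWw i]
    exact hx i
  · rintro y ⟨hy, hyw⟩
    refine hε.eq_of_ptsOfPeriod hn hy hper fun i hi => ?_
    have h1 := hyw ⟨i, Nat.lt_succ_of_lt hi⟩
    rw [← hWw] at h1
    exact hclose _ _ _ h1 (hx i)

/-- The trace of a power of a signed matrix splits into contributions of the periodic points. -/
theorem IsMarkovCover.trace_signedMatrix_pow [CompactSpace K]
    (hf : IsRuelleExpandingWith f r lam c) (hε : IsExpansiveConstant f ε)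
    (hR : IsMarkovCover f δ R) (hδ : δ ≤ c / 2) (hδε : δ ≤ ε) {m n : ℕ} (hm : 1 ≤ m) (hn : 1 ≤ n)
    (hfin : (Function.ptsOfPeriod f n).Finite) :
    (signedMatrix f R m ^ n).trace = ∑ x ∈ hfin.toFinset, ((List.ofFn fun i : Fin n =>
      pointTransition f R (f^[i] x) (f^[i + 1] x)).prod.compound m).trace := by
  classical
  have hpow : signedMatrix f R m ^ n = (List.ofFn fun _ : Fin n => signedMatrix f R m).prod := by
    rw [List.ofFn_const, List.prod_replicate]
  simp only [Matrix.compound_list_prod, List.map_ofFn, Function.comp_def]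
  have hsub : ∀ x : K, (List.ofFn fun i : Fin n =>
      (pointTransition f R (f^[i] x) (f^[i + 1] x)).compound m).prod.trace = _ := fun x =>
    (Matrix.trace_list_ofFn_prod_submatrix (CoverIndex.toPowersetCard (R := R) (m := m))
      CoverIndex.toPowersetCard_injective (Nat.one_le_iff_ne_zero.mp hn)
      (fun i : Fin n => (pointTransition f R (f^[i] x) (f^[i + 1] x)).compound m)
      fun i s t ht => compound_pointTransition_eq_zero _ _ s t ht).symm
  simp only [hsub, hpow, Matrix.trace_list_ofFn_prod, Matrix.submatrix_apply,
    hR.compound_pointTransition hf hδ]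
  rw [Finset.sum_comm]
  refine Finset.sum_congr rfl fun w _ => ?_
  split_ifs with hw
  · by_cases hne : ∀ i : Fin n, signedMatrix f R m (w i.castSucc) (w i.succ) ≠ 0
    · obtain ⟨x, ⟨hx, hxw⟩, huniq⟩ :=
        hR.existsUnique_ptsOfPeriod hf hε hδ hδε hm hn hw hne
      rw [Finset.sum_eq_single x]
      · refine Finset.prod_congr rfl fun i _ => ?_
        exact (if_pos ⟨hxw i.castSucc, hxw i.succ⟩).symm
      · intro y hy hyx
        by_contra hprod
        rw [← Ne, Finset.prod_ne_zero_iff] at hprod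
        have hmask : ∀ i : Fin n, f^[i] y ∈ (⋂ a ∈ (w i.castSucc).1, R a) ∧
            f^[i + 1] y ∈ ⋂ a ∈ (w i.succ).1, R a := by
          intro i
          by_contra h
          exact hprod i (Finset.mem_univ i) (if_neg h)
        refine hyx (huniq y ⟨by simpa using hy, fun i => ?_⟩)
        rcases Fin.eq_zero_or_eq_succ i with rfl | ⟨j, rfl⟩
        · exact (hmask ⟨0, hn⟩).1
        · exact (hmask j).2
      · intro h
        exact absurd (by simpa using hx) h
    · push Not at hne
      obtain ⟨i, hi⟩ := hne
      rw [Finset.prod_eq_zero (Finset.mem_univ i) hi]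
      refine (Finset.sum_eq_zero fun x _ => ?_).symm
      exact Finset.prod_eq_zero (Finset.mem_univ i) (by rw [hi, ite_self])
  · simp

/-- Each periodic point contributes `1` in total, over all sizes of index sets; sizes above the
largest overlap have an empty index type and contribute nothing. -/
theorem IsMarkovCover.periodicCount_eq_sum_trace [CompactSpace K]
    (hf : IsRuelleExpandingWith f r lam c) (hε : IsExpansiveConstant f ε)
    (hR : IsMarkovCover f δ R) (hδ : δ ≤ c / 2) (hδε : δ ≤ ε) {n : ℕ} (hn : 1 ≤ n) :
    (periodicCount f n : ℤ) =
      ∑ m ∈ Finset.Icc 1 (maxOverlap R), (-1) ^ (m + 1) * (signedMatrix f R m ^ n).trace := by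
  classical
  obtain ⟨N, hN⟩ := hε.exists_periodicCount_le
  have hfin := (hN n hn).1
  have hsub : Finset.Icc 1 (maxOverlap R) ⊆ Finset.Icc 1 k := by
    refine Finset.Icc_subset_Icc_right (Finset.sup_le fun m hm => ?_)
    exact (Finset.mem_Icc.mp (Finset.mem_filter.mp hm).1).2
  rw [Finset.sum_subset hsub]
  · rw [periodicCount, Set.ncard_eq_toFinset_card _ hfin, Finset.card_eq_sum_ones, Nat.cast_sum]
    have htrace := fun m (hm : m ∈ Finset.Icc 1 k) => congrArg ((-1 : ℤ) ^ (m + 1) * ·)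
      (hR.trace_signedMatrix_pow hf hε hδ hδε (Finset.mem_Icc.mp hm).1 hn hfin)
    rw [Finset.sum_congr rfl htrace]
    simp only [Finset.mul_sum]
    rw [Finset.sum_comm]
    refine Finset.sum_congr rfl fun x hx => ?_
    rw [hR.sum_trace_compound_prod hf hδ (by simpa using hx), Nat.cast_one]
  · intro m hm hm'
    have hempty : IsEmpty (CoverIndex R m) := by
      rw [← not_nonempty_iff]
      intro h
      refine hm' (Finset.mem_Icc.mpr ⟨(Finset.mem_Icc.mp hm).1, ?_⟩)
      exact Finset.le_sup (f := id) (Finset.mem_filter.mpr ⟨hm, h⟩)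
    rw [Matrix.trace, Finset.univ_eq_empty, Finset.sum_empty, mul_zero]

end Coding

/-! ### The zeta function as a rational function -/

theorem analyticOnNhd_zetaFun {K : Type*} {f : K → K} (h : 0 < zetaRadius f) {s : Set ℂ}
    (hs : ∀ t ∈ s, (‖t‖₊ : ENNReal) < zetaRadius f) : AnalyticOnNhd ℂ (zetaFun f) s := by
  have h1 := (FormalMultilinearSeries.ofScalars ℂ (zetaCoeff f)).hasFPowerSeriesOnBall h
  have h2 : zetaFun f =
      fun t => Complex.exp ((FormalMultilinearSeries.ofScalars ℂ (zetaCoeff f)).sum t) := by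
    funext t
    have := FormalMultilinearSeries.ofScalars_sum_eq (E := ℂ) (zetaCoeff f) t
    simp only [smul_eq_mul] at this
    rw [zetaFun, ← this]
    rfl
  rw [h2]
  intro t ht
  refine (h1.analyticOnNhd t ?_).cexp
  simpa [enorm, zetaRadius] using hs t ht

/-- By the identity theorem, a quotient of polynomials that agrees with the zeta function near `0`
agrees with it, in lowest terms, on the whole disc of convergence. -/
theorem zetaEqRatFunc_of_eventually {K : Type*} {f : K → K} (h : 0 < zetaRadius f)
    {N D : Polynomial ℂ} (hD : D.eval 0 ≠ 0)
    (hND : ∀ᶠ t in nhds (0 : ℂ), zetaFun f t * D.eval t = N.eval t) :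
    ZetaEqRatFunc f (algebraMap (Polynomial ℂ) (RatFunc ℂ) N /
      algebraMap (Polynomial ℂ) (RatFunc ℂ) D) := by
  set q := algebraMap (Polynomial ℂ) (RatFunc ℂ) N / algebraMap (Polynomial ℂ) (RatFunc ℂ) D
    with hq
  have hD0 : D ≠ 0 := by
    rintro rfl
    simp at hD
  have hnum : q.num * D = N * q.denom := (RatFunc.num_mul_eq_mul_denom_iff hD0).mpr hq
  have hlocal : (fun t => zetaFun f t * q.denom.eval t) =ᶠ[nhds 0] fun t => q.num.eval t := by
    filter_upwards [hND, D.continuous.continuousAt.eventually_ne hD] with t ht hDt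
    have h1 := congrArg (Polynomial.eval t) hnum
    rw [Polynomial.eval_mul, Polynomial.eval_mul] at h1
    refine mul_right_cancel₀ hDt ?_
    rw [h1, ← ht]
    ring
  intro t ht
  obtain ⟨ρ, htρ, hρ⟩ := ENNReal.lt_iff_exists_nnreal_btwn.mp ht
  have htρ' : ‖t‖ < ρ := by exact_mod_cast htρ
  have hball : ∀ z ∈ Metric.ball (0 : ℂ) ρ, (‖z‖₊ : ENNReal) < zetaRadius f := by
    intro z hz
    refine lt_trans ?_ hρ
    rw [mem_ball_zero_iff] at hz
    exact_mod_cast hz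
  have hpoly : ∀ p : Polynomial ℂ,
      AnalyticOnNhd ℂ (fun z => p.eval z) (Metric.ball (0 : ℂ) ρ) := fun p z _ => by
    simpa using AnalyticAt.aeval_polynomial (analyticAt_id (𝕜 := ℂ) (z := z)) p
  have heq := AnalyticOnNhd.eqOn_of_preconnected_of_eventuallyEq
    ((analyticOnNhd_zetaFun h hball).mul (hpoly q.denom)) (hpoly q.num)
    (convex_ball (0 : ℂ) ρ).isPreconnected
    (Metric.mem_ball_self ((norm_nonneg t).trans_lt htρ')) hlocal
  have ht' : zetaFun f t * q.denom.eval t = q.num.eval t := heq (mem_ball_zero_iff.mpr htρ')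
  have hden : q.denom.eval t ≠ 0 := by
    intro h0
    rw [h0, mul_zero] at ht'
    obtain ⟨u, v, huv⟩ := q.isCoprime_num_denom
    have := congrArg (Polynomial.eval t) huv
    rw [Polynomial.eval_add, Polynomial.eval_mul, Polynomial.eval_mul, h0, ← ht'] at this
    simp at this
  exact ⟨hden, (eq_div_iff hden).mpr ht'⟩

theorem detPoly_eq_charpolyRev {K : Type*} [MetricSpace K] (f : K → K) {k : ℕ}
    (R : Fin k → Set K) (m : ℕ) :
    detPoly f R m = ((Int.castRingHom ℂ).mapMatrix (signedMatrix f R m)).charpolyRev := rfl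

theorem IsMarkovCover.zetaEqRatFunc {K : Type*} [MetricSpace K] [CompactSpace K] {f : K → K}
    {r lam c δ ε : ℝ} {k : ℕ} {R : Fin k → Set K} (hf : IsRuelleExpandingWith f r lam c)
    (hε : IsExpansiveConstant f ε) (hR : IsMarkovCover f δ R) (hδ : δ ≤ c / 2) (hδε : δ ≤ ε) :
    ZetaEqRatFunc f (coverRatFunc f R) := by
  obtain ⟨N, hN⟩ := hε.exists_periodicCount_le
  unfold coverRatFunc
  rw [← map_prod, ← map_prod]
  refine zetaEqRatFunc_of_eventually
    (zetaRadius_pos_of_periodicCount_le fun n hn => (hN n hn).2) ?_ ?_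
  · rw [Polynomial.eval_prod]
    refine Finset.prod_ne_zero_iff.mpr fun m _ => ?_
    rw [detPoly_eq_charpolyRev, Matrix.eval_charpolyRev]
    exact one_ne_zero
  have hcoeff : ∀ n, zetaCoeff f n = ∑ m ∈ Finset.Icc 1 (maxOverlap R), (-1) ^ (m + 1) *
      (((Int.castRingHom ℂ).mapMatrix (signedMatrix f R m) ^ n).trace / (n : ℂ)) := by
    intro n
    rcases Nat.eq_zero_or_pos n with rfl | hn
    · simp [zetaCoeff]
    · have h1 := congrArg (Int.cast : ℤ → ℂ) (hR.periodicCount_eq_sum_trace hf hε hδ hδε hn)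
      push_cast at h1
      rw [zetaCoeff, if_neg hn.ne', h1, Finset.sum_div]
      refine Finset.sum_congr rfl fun m _ => ?_
      rw [← map_pow, mul_div_assoc]
      simp [Matrix.trace]
  have hev := (Filter.eventually_all_finset (Finset.Icc 1 (maxOverlap R))).mpr fun m _ =>
    ((Int.castRingHom ℂ).mapMatrix
      (signedMatrix f R m)).exists_hasSum_trace_pow_exp_mul_charpolyRev
  filter_upwards [hev] with t ht
  choose! S hS hexp using ht
  have hsum : HasSum (fun n => zetaCoeff f n * t ^ n)
      (∑ m ∈ Finset.Icc 1 (maxOverlap R), (-1) ^ (m + 1) * S m) := by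
    have := hasSum_sum fun m hm => (hS m hm).mul_left ((-1) ^ (m + 1))
    refine this.congr_fun fun n => ?_
    rw [hcoeff, Finset.sum_mul]
    exact Finset.sum_congr rfl fun m _ => by ring
  rw [zetaFun, hsum.tsum_eq, Complex.exp_sum, Polynomial.eval_prod, Polynomial.eval_prod,
    Finset.prod_filter, Finset.prod_filter, ← Finset.prod_mul_distrib]
  refine Finset.prod_congr rfl fun m hm => ?_
  have hm' := hexp m hm
  rw [← detPoly_eq_charpolyRev] at hm'
  rcases Nat.even_or_odd m with he | ho
  · rw [if_neg (Nat.not_odd_iff_even.mpr he), if_pos he, he.add_one.neg_one_pow, mul_one,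
      neg_one_mul, Complex.exp_neg]
    exact inv_eq_of_mul_eq_one_right hm'
  · rw [if_pos ho, if_neg (Nat.not_even_iff_odd.mpr ho), ho.add_one.neg_one_pow, one_mul, hm']

theorem mainTheorem1 {K : Type*} [MetricSpace K] [CompactSpace K] (f : K → K)
    (hf : IsRuelleExpanding f) :
    (∀ n : ℕ, 1 ≤ n → (Function.ptsOfPeriod f n).Finite) ∧
    0 < zetaRadius f ∧
    (∃ q : RatFunc ℂ, ZetaEqRatFunc f q) ∧
    (∃ ε : ℝ, IsExpansiveConstant f ε) ∧
    ∀ r lam c ε : ℝ, IsRuelleExpandingWith f r lam c → IsExpansiveConstant f ε →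
      (∃ (k : ℕ) (R : Fin k → Set K), IsMarkovCover f (min ε (c / 2)) R) ∧
      ∀ (k : ℕ) (R : Fin k → Set K), IsMarkovCover f (min ε (c / 2)) R →
        ZetaEqRatFunc f (coverRatFunc f R) := by
  obtain ⟨r, lam, c, hf⟩ := hf
  have hε := hf.isExpansiveConstant
  obtain ⟨N, hN⟩ := hε.exists_periodicCount_le
  have hzeta : ∀ r lam c ε : ℝ, IsRuelleExpandingWith f r lam c → IsExpansiveConstant f ε →
      ∀ (k : ℕ) (R : Fin k → Set K), IsMarkovCover f (min ε (c / 2)) R →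
        ZetaEqRatFunc f (coverRatFunc f R) := fun r lam c ε hf hε k R hR =>
    hR.zetaEqRatFunc hf hε (min_le_right _ _) (min_le_left _ _)
  have hcover : ∀ r lam c ε : ℝ, IsRuelleExpandingWith f r lam c → IsExpansiveConstant f ε →
      ∃ (k : ℕ) (R : Fin k → Set K), IsMarkovCover f (min ε (c / 2)) R :=
    fun r lam c ε hf hε => hf.exists_isMarkovCover (lt_min hε.1 (half_pos hf.c_pos))
  obtain ⟨k, R, hR⟩ := hcover r lam c _ hf hε
  exact ⟨fun n hn => (hN n hn).1,
    zetaRadius_pos_of_periodicCount_le fun n hn => (hN n hn).2,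
    ⟨_, hzeta r lam c _ hf hε k R hR⟩, ⟨_, hε⟩,
    fun r lam c ε hf hε => ⟨hcover r lam c ε hf hε, hzeta r lam c ε hf hε⟩⟩
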